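/- \textbf{Definitions.} All Banach spaces are real. The density of a topological space is the least cardinality of a dense subset. For a set $X$ and $d\ge 1$, $[X]^d$ is the set of $d$-element subsets of $X$ and $[X]^{<\omega}$ is the set of finite subsets of $X$. For a cardinal $\kappa$ and an integer $d\ge 1$, the polarized partition principle $\mathrm{Pl}_d(\kappa)$ asserts that for every coloring $c:\big[[\kappa]^d\big]^{<\omega}\to\omega$ there is a sequence $(\mathbf{x}_n)_{n\in\omega}$ of pairwise disjoint infinite subsets of $\kappa$ such that for every $m\in\omega$ the coloring $c$ is constant on $\prod_{n=0}^m[\mathbf{x}_n]^d$, where a tuple $(s_0,\dots,s_m)$ in the product is identified with the finite set $\{s_0,\dots,s_m\}$. A Banach space contains $\ell_1$ if it has a subspace isomorphic (linearly homeomorphic) to $\ell_1$. A sequence $(x_n)_{n\in\omega}$ in a Banach space is basic if it is a Schauder basis of its closed linear span. For $C\ge 1$ it is $C$-unconditional if for all non-empty finite sets $F\subseteq G\subseteq\omega$ and all scalars $(a_n)_{n\in G}$, \[ \Big\|\sum_{n\in F}a_nx_n\Big\|\le C\,\Big\|\sum_{n\in G}a_nx_n\Big\|. \] \textbf{Theorem.}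 Let $\kappa$ be a cardinal such that $\mathrm{Pl}_2(\kappa)$ holds. Then every Banach space of density $\kappa$ that does not contain $\ell_1$ contains a $1$-unconditional basic sequence. In particular, if $E$ is any Banach space of density $\kappa$, then for every $\varepsilon>0$ the space $E$ contains a $(1+\varepsilon)$-unconditional basic sequence. -/

import Mathlib

universe u

/-- The density character of a topological space: the least cardinality of a dense subset. -/
noncomputable def densityCharacter (E : Type u) [TopologicalSpace E] : Cardinal.{u} :=
  sInf {c : Cardinal.{u} | ∃ s : Set E, Dense s ∧ Cardinal.mk s = c}

open Classical in
/-- The polarized partition principle `Pl_d(κ)` (for `d ≥ 1`): for every coloring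
`c : [[κ]^d]^{<ω} → ω` of the finite sets of `d`-element subsets of `κ` there are pairwise disjoint
infinite sets `x 0, x 1, … ⊆ κ` such that for every `m` the coloring `c` is constant on
`[x 0]^d × ⋯ × [x m]^d`, where a tuple `(s 0, …, s m)` in this product is identified
with the finite set `{s 0, …, s m}`. -/
def PolarizedPartition (d : ℕ) (κ : Cardinal.{u}) : Prop :=
  ∀ c : Finset (Set.powersetCard κ.out d) → ℕ,
    ∃ x : ℕ → Set κ.out,
      (∀ n, (x n).Infinite) ∧ (∀ i j, i ≠ j → Disjoint (x i) (x j)) ∧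
        ∀ m : ℕ, ∃ k : ℕ, ∀ s : Fin (m + 1) → Set.powersetCard κ.out d,
          (∀ n : Fin (m + 1), (((s n : Finset κ.out) : Set κ.out) ⊆ x n)) →
            c (Finset.univ.image s) = k

section BanachSpaces

variable {E : Type u} [NormedAddCommGroup E] [NormedSpace ℝ E]

/-- A sequence is basic if it is a Schauder basis of its closed linear span. -/
def IsBasicSequence (x : ℕ → E) : Prop :=
  ∃ b : SchauderBasis ℝ (Submodule.span ℝ (Set.range x)).topologicalClosure,
    ∀ n, (b n : E) = x n

/-- `x` is `C`-unconditional: `‖∑_{n ∈ F} a_n x_n‖ ≤ C ‖∑_{n ∈ G} a_n x_n‖` for all non-empty finite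
`F ⊆ G` and all scalars. -/
def IsUnconditionalWith (C : ℝ) (x : ℕ → E) : Prop :=
  ∀ F G : Finset ℕ, F.Nonempty → G.Nonempty → F ⊆ G → ∀ a : ℕ → ℝ,
    ‖∑ n ∈ F, a n • x n‖ ≤ C * ‖∑ n ∈ G, a n • x n‖

variable (E) in
/-- `E` contains a `C`-unconditional basic sequence. -/
def HasUnconditionalBasicSequence (C : ℝ) : Prop :=
  ∃ x : ℕ → E, IsBasicSequence x ∧ IsUnconditionalWith C x

variable (E) in
/-- `E` contains an isomorphic copy of `ℓ₁`: there is a bounded linear map `ℓ₁ → E` that is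
bounded below. -/
def ContainsEllOne : Prop :=
  ∃ T : lp (fun _ : ℕ => ℝ) 1 →L[ℝ] E, ∃ δ : ℝ, 0 < δ ∧ ∀ v, δ * ‖v‖ ≤ ‖T v‖

end BanachSpaces

/-! ### Unconditional sequences in normed spaces. -/

section Analysis

variable {E : Type u} [NormedAddCommGroup E] [NormedSpace ℝ E]

/-! Take κ distinct points `e a` of the unit ball, well-order the indices, and attach to each pair
of indices the difference of its two points. The wanted sequence uses one pair from each homogeneous
set.

A finite family of pairs is coloured by whether its members are successive blocks and, if so, by a
chosen failure of 1-unconditionality: integer coefficients, placed by rank in the block order, with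
gap 1. There are only countably many colours. Block selections exist (`exists_pairwise_blockLT`), so
homogeneity makes every selection a block family and orders the sets themselves
(`forall_lt_or_forall_lt`). Ranks then recover the indices lost in passing from tuples to finite
sets.

A recorded failure would be common to all selections, but `exists_norm_sum_le_add_one` produces a
selection escaping it: take a norming functional of the subsum and, by pigeonhole, choose the
remaining pairs so that it nearly vanishes on their differences. Scaling then removes the gap and
the integrality (`norm_sum_le_of_forall_int`). -/

theorem IsUnconditionalWith.mono {C D : ℝ} {x : ℕ → E} (h : IsUnconditionalWith C x) (hCD : C ≤ D) :
    IsUnconditionalWith D x := fun F G hF hG hFG a =>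
  (h F G hF hG hFG a).trans (mul_le_mul_of_nonneg_right hCD (norm_nonneg _))

theorem HasUnconditionalBasicSequence.mono {C D : ℝ} (h : HasUnconditionalBasicSequence E C)
    (hCD : C ≤ D) : HasUnconditionalBasicSequence E D :=
  let ⟨x, hx, hC⟩ := h
  ⟨x, hx, hC.mono hCD⟩

/-- The linear map sending a finitely supported sequence `a` to `∑ a n • x n`, with values in the
closed linear span of `x`. -/
noncomputable def toClosedSpan (x : ℕ → E) :
    (ℕ →₀ ℝ) →ₗ[ℝ] (Submodule.span ℝ (Set.range x)).topologicalClosure :=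
  (Finsupp.linearCombination ℝ x).codRestrict _ fun l =>
    Submodule.le_topologicalClosure _
      (Finsupp.range_linearCombination ℝ (v := x) ▸ LinearMap.mem_range_self _ l)

theorem coe_toClosedSpan (x : ℕ → E) (l : ℕ →₀ ℝ) :
    (toClosedSpan x l : E) = Finsupp.linearCombination ℝ x l := rfl

theorem denseRange_toClosedSpan (x : ℕ → E) : DenseRange (toClosedSpan x) := by
  intro y
  rw [closure_subtype]
  have h : ((↑) '' Set.range (toClosedSpan x) : Set E) = Submodule.span ℝ (Set.range x) := by
    rw [← Set.range_comp]
    exact congrArg SetLike.coe (Finsupp.range_linearCombination ℝ (v := x))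
  rw [h, ← Submodule.topologicalClosure_coe]
  exact y.2

theorem IsUnconditionalWith.norm_sum_range_le {C : ℝ} {x : ℕ → E} (hC : IsUnconditionalWith C x)
    (F : Finset ℕ) (hF : F.Nonempty) (l : ℕ →₀ ℝ) :
    ‖∑ n ∈ F, l n • x n‖ ≤ C * ‖toClosedSpan x l‖ := by
  have h := hC F (F ∪ l.support) hF (hF.mono Finset.subset_union_left) Finset.subset_union_left l
  have h2 : (toClosedSpan x l : E) = ∑ n ∈ F ∪ l.support, l n • x n := by
    rw [coe_toClosedSpan, Finsupp.linearCombination_apply,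
      Finsupp.sum_of_support_subset l Finset.subset_union_right _ (by simp)]
  rwa [Submodule.coe_norm, h2]

/-- Initial segments are among the sets `F`, so the partial-sum projections are uniformly bounded by
`C` on a dense subspace, where they are eventually the identity. -/
theorem IsUnconditionalWith.isBasicSequence {C : ℝ} {x : ℕ → E} (hC : IsUnconditionalWith C x)
    (hx : ∀ n, x n ≠ 0) : IsBasicSequence x := by
  classical
  set V := (Submodule.span ℝ (Set.range x)).topologicalClosure
  set T := toClosedSpan x with hT
  have hd : DenseRange T := denseRange_toClosedSpan x
  let coord : ℕ → StrongDual ℝ V := fun n => (Finsupp.lapply n : (ℕ →₀ ℝ) →ₗ[ℝ] ℝ).extendOfNorm T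
  have hcoord : ∀ n l, coord n (T l) = l n := fun n l => by
    refine LinearMap.extendOfNorm_eq hd ⟨C / ‖x n‖, fun l => ?_⟩ l
    have := hC.norm_sum_range_le {n} (by simp) l
    rw [div_mul_eq_mul_div, le_div_iff₀ (norm_pos_iff.2 (hx n))]
    simpa [norm_smul] using this
  let b : ℕ → V := fun n => T (Finsupp.single n 1)
  have hb : ∀ n, (b n : E) = x n := fun n => by simp [b, hT, coe_toClosedSpan]
  let P : ℕ → V →L[ℝ] V := fun n => ∑ i ∈ Finset.range n, (coord i).smulRight (b i)
  have hP : ∀ n v, P n v = ∑ i ∈ Finset.range n, coord i v • b i := fun n v => by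
    simp [P]
  have hC0 : 0 ≤ C := by
    have := hC {0} {0} (by simp) (by simp) subset_rfl 1
    simp only [Finset.sum_singleton, Pi.one_apply, one_smul] at this
    nlinarith [norm_pos_iff.2 (hx 0)]
  have hbound : ∀ n v, ‖P n v‖ ≤ C * ‖v‖ := fun n v => by
    refine hd.induction_on v (isClosed_le (by fun_prop) (by fun_prop)) fun l => ?_
    rcases Nat.eq_zero_or_pos n with rfl | hn
    · simpa [P] using mul_nonneg hC0 (norm_nonneg (T l))
    · have := hC.norm_sum_range_le (Finset.range n) (by simpa using hn.ne') l
      rw [hP, Submodule.coe_norm]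
      simpa [hcoord, hb] using this
  have hfix : ∀ l : ℕ →₀ ℝ, ∃ N, ∀ n ≥ N, P n (T l) = T l := fun l => by
    obtain ⟨N, hN⟩ := l.support.exists_nat_subset_range
    refine ⟨N, fun n hn => Subtype.ext ?_⟩
    rw [hP, hT, coe_toClosedSpan, Finsupp.linearCombination_apply, Finsupp.sum_of_support_subset l
      (hN.trans (Finset.range_mono hn)) _ (by simp)]
    simp [← hT, hcoord, hb]
  refine ⟨⟨b, coord, fun i j => ?_, fun v => ?_⟩, hb⟩
  · simp [b, hcoord, Finsupp.single_apply, Pi.single_apply, eq_comm]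
  · rw [HasSum, SummationFilter.conditional_filter_eq_map_range, Filter.tendsto_map'_iff,
      Metric.tendsto_atTop]
    intro ε hε
    -- The error of `P n` at `v` is at most `C + 1` times the distance from `v` to `T l`.
    obtain ⟨l, hl⟩ := hd.exists_dist_lt v (show 0 < ε / (C + 1) by positivity)
    obtain ⟨N, hN⟩ := hfix l
    refine ⟨N, fun n hn => ?_⟩
    have h1 : P n v - v = P n (v - T l) - (v - T l) := by rw [map_sub, hN n hn]; abel
    rw [Function.comp, ← hP, dist_eq_norm, h1]
    rw [dist_eq_norm, lt_div_iff₀ (by positivity)] at hl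
    calc _ ≤ ‖P n (v - T l)‖ + ‖v - T l‖ := norm_sub_le _ _
      _ ≤ C * ‖v - T l‖ + ‖v - T l‖ := by gcongr; exact hbound _ _
      _ < ε := by linarith

/-- Round `N * a i` down to integers: both sides change by at most `K`, independently of `N`, so
dividing by `N` makes the total error `2 * K + 1` negligible. -/
theorem norm_sum_le_of_forall_int {ι : Type*} [Fintype ι] (y : ι → E) (F : Finset ι)
    (h : ∀ b : ι → ℤ, ‖∑ i ∈ F, (b i : ℝ) • y i‖ ≤ ‖∑ i, (b i : ℝ) • y i‖ + 1) (a : ι → ℝ) :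
    ‖∑ i ∈ F, a i • y i‖ ≤ ‖∑ i, a i • y i‖ := by
  set K := ∑ i, ‖y i‖
  have happrox : ∀ (N : ℕ) (G : Finset ι),
      ‖(N : ℝ) • ∑ i ∈ G, a i • y i - ∑ i ∈ G, ((⌊N * a i⌋ : ℤ) : ℝ) • y i‖ ≤ K := by
    intro N G
    rw [Finset.smul_sum, ← Finset.sum_sub_distrib]
    refine (norm_sum_le _ _).trans ((Finset.sum_le_sum fun i _ => ?_).trans
      (Finset.sum_le_univ_sum_of_nonneg fun i => norm_nonneg (y i)))
    rw [smul_smul, ← sub_smul, norm_smul]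
    refine mul_le_of_le_one_left (norm_nonneg _) ?_
    rw [Real.norm_eq_abs, abs_le]
    constructor <;> linarith [Int.floor_le (N * a i), Int.lt_floor_add_one (N * a i)]
  refine le_of_forall_pos_lt_add fun ε hε => ?_
  obtain ⟨N, hN⟩ := exists_nat_gt ((2 * K + 1) / ε)
  rw [div_lt_iff₀ hε] at hN
  have h1 := norm_sub_norm_le ((N : ℝ) • ∑ i ∈ F, a i • y i) (∑ i ∈ F, ((⌊N * a i⌋ : ℤ) : ℝ) • y i)
  have h2 := norm_sub_norm_le (∑ i, ((⌊N * a i⌋ : ℤ) : ℝ) • y i) ((N : ℝ) • ∑ i, a i • y i)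
  rw [norm_sub_rev] at h2
  rw [norm_smul, Real.norm_natCast] at h1 h2
  have h3 := happrox N F
  have h4 := happrox N Finset.univ
  have h5 := h fun i => ⌊N * a i⌋
  have hK : 0 ≤ K := Finset.sum_nonneg fun i _ => norm_nonneg _
  have hN0 : (0 : ℝ) < N := by
    by_contra hcon
    nlinarith [Nat.cast_nonneg (α := ℝ) N]
  nlinarith

theorem Set.Infinite.exists_ne_abs_apply_sub_lt {I : Type*} {x : Set I} (hx : x.Infinite) {e : I → E}
    (he : ∀ a, ‖e a‖ ≤ 1) (f : StrongDual ℝ E) {η : ℝ} (hη : 0 < η) :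
    ∃ a ∈ x, ∃ b ∈ x, a ≠ b ∧ |f (e a - e b)| < η := by
  -- Pigeonhole: infinitely many bounded values fall into finitely many cells of length `η`.
  have hmaps : Set.MapsTo (fun a => ⌊f (e a) / η⌋) x
      (Set.Icc ⌊-‖f‖ / η⌋ ⌊‖f‖ / η⌋) := by
    intro a _
    have h : |f (e a)| ≤ ‖f‖ := by
      simpa using (f.le_opNorm (e a)).trans (mul_le_of_le_one_right (norm_nonneg f) (he a))
    obtain ⟨h1, h2⟩ := abs_le.1 h
    constructor <;> (apply Int.floor_le_floor; gcongr)
  obtain ⟨a, ha, b, hb, hab, h⟩ := hx.exists_ne_map_eq_of_mapsTo hmaps (Set.finite_Icc _ _)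
  refine ⟨a, ha, b, hb, hab, ?_⟩
  have := Int.abs_sub_lt_one_of_floor_eq_floor h
  rwa [← sub_div, abs_div, abs_of_pos hη, div_lt_one hη, ← map_sub] at this

end Analysis

/-! ### Selecting successive pairs in a well-order. -/

section BlockSequences

variable {I : Type u}

theorem Set.powersetCard.exists_mem (s : Set.powersetCard I 2) : ∃ a, a ∈ s :=
  Set.powersetCard.coe_nonempty_iff.2 one_le_two

theorem injective_of_forall_subset {ι : Type*} {x : ι → Set I}
    (hdisj : Pairwise fun i j => Disjoint (x i) (x j)) {s : ι → Set.powersetCard I 2}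
    (hs : ∀ i, ((s i : Finset I) : Set I) ⊆ x i) : Function.Injective s := by
  intro i j hij
  by_contra hne
  obtain ⟨a, ha⟩ := Set.powersetCard.exists_mem (s i)
  exact Set.disjoint_left.1 (hdisj hne) (hs i ha) (hs j (hij ▸ ha))

theorem Set.Infinite.exists_powersetCard_subset {x : Set I} (hx : x.Infinite) {n : ℕ} :
    ∃ s : Set.powersetCard I n, ((s : Finset I) : Set I) ⊆ x :=
  let ⟨s, hs, hn⟩ := hx.exists_subset_card_eq n
  ⟨⟨s, hn⟩, hs⟩

variable [LinearOrder I]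

/-- Every element of `s` is below every element of `t`. -/
def BlockLT (s t : Set.powersetCard I 2) : Prop := ∀ a ∈ s, ∀ b ∈ t, a < b

/-- Any two distinct members of `S` are comparable as blocks. -/
def IsBlockFamily (S : Set (Set.powersetCard I 2)) : Prop :=
  S.Pairwise fun s t => BlockLT s t ∨ BlockLT t s

theorem Set.Infinite.exists_pair_subset {x : Set I} (hx : x.Infinite) {a b : I} (ha : a ∈ x)
    (hb : b ∈ x) :
    ∃ s : Set.powersetCard I 2, ((s : Finset I) : Set I) ⊆ x ∧ a ∈ s ∧ b ∈ s := by
  have key : ∀ a ∈ x, ∀ b ∈ x, a ≠ b →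
      ∃ s : Set.powersetCard I 2, ((s : Finset I) : Set I) ⊆ x ∧ a ∈ s ∧ b ∈ s := by
    intro a ha b hb hab
    refine ⟨⟨{a, b}, Finset.card_pair hab⟩, ?_, ?_, ?_⟩
    · intro c hc
      rcases (by simpa using hc : c = a ∨ c = b) with rfl | rfl <;> assumption
    · simp [← Set.powersetCard.mem_coe_iff]
    · simp [← Set.powersetCard.mem_coe_iff]
  by_cases hab : a = b
  · obtain ⟨c, hc, hca⟩ := hx.exists_notMem_finset {a}
    obtain ⟨s, hs, h, -⟩ := key a ha c hc (by simpa [eq_comm] using hca)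
    exact ⟨s, hs, h, hab ▸ h⟩
  · exact key a ha b hb hab

variable [WellFoundedLT I]

/-- Take the least `β` below which some set is already infinite and pick the pair strictly below `β`
in that set. By minimality no set loses more than finitely many points. If no such `β` exists, any
pair works. -/
theorem exists_pair_forall_infinite_inter_Ioi {ι : Type*} {J : Finset ι} (hJ : J.Nonempty)
    {x : ι → Set I} (hx : ∀ j ∈ J, (x j).Infinite) :
    ∃ j ∈ J, ∃ a ∈ x j, ∃ b ∈ x j, a < b ∧ ∀ i ∈ J, (x i ∩ Set.Ioi b).Infinite := by
  have hIoi : ∀ b, ∀ i ∈ J, (x i ∩ Set.Iic b).Finite → (x i ∩ Set.Ioi b).Infinite := by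
    intro b i hi hfin hfin'
    refine hx i hi ((hfin.union hfin').subset fun c hc => ?_)
    rcases le_or_gt c b with h | h
    exacts [Or.inl ⟨hc, h⟩, Or.inr ⟨hc, h⟩]
  have hlt : ∀ y : Set I, y.Infinite → ∃ a ∈ y, ∃ b ∈ y, a < b := by
    intro y hy
    obtain ⟨a, ha, b, hb, hab⟩ := hy.nontrivial
    rcases lt_or_gt_of_ne hab with h | h
    exacts [⟨a, ha, b, hb, h⟩, ⟨b, hb, a, ha, h⟩]
  by_cases hB : ∃ b, ∃ i ∈ J, (x i ∩ Set.Iic b).Infinite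
  · obtain ⟨β, ⟨j, hj, hβ⟩, hmin⟩ := WellFounded.has_min (wellFounded_lt (α := I))
      {b | ∃ i ∈ J, (x i ∩ Set.Iic b).Infinite} hB
    have hβ' : (x j ∩ Set.Iio β).Infinite := by
      intro hfin
      refine hβ ((hfin.union (Set.finite_singleton β)).subset fun c hc => ?_)
      rcases lt_or_eq_of_le hc.2 with h | h
      exacts [Or.inl ⟨hc.1, h⟩, Or.inr h]
    obtain ⟨a, ha, b, hb, hab⟩ := hlt _ hβ'
    refine ⟨j, hj, a, ha.1, b, hb.1, hab, fun i hi => hIoi b i hi ?_⟩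
    by_contra hinf
    exact hmin b ⟨i, hi, hinf⟩ hb.2
  · push Not at hB
    obtain ⟨j, hj⟩ := hJ
    obtain ⟨a, ha, b, hb, hab⟩ := hlt _ (hx j hj)
    exact ⟨j, hj, a, ha, b, hb, hab, fun i hi => hIoi b i hi (hB b i hi)⟩

theorem exists_pairwise_blockLT [Nonempty (Set.powersetCard I 2)] {ι : Type*} (J : Finset ι) :
    ∀ x : ι → Set I, (∀ j ∈ J, (x j).Infinite) →
      ∃ s : ι → Set.powersetCard I 2, (∀ j ∈ J, ((s j : Finset I) : Set I) ⊆ x j) ∧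
        (J : Set ι).Pairwise fun i j => BlockLT (s i) (s j) ∨ BlockLT (s j) (s i) := by
  classical
  induction J using Finset.strongInduction with
  | H J ih =>
    intro x hx
    rcases J.eq_empty_or_nonempty with rfl | hJ
    · exact ⟨fun _ => Classical.arbitrary _, by simp, by simp⟩
    obtain ⟨j, hj, a, ha, b, hb, hab, hinf⟩ := exists_pair_forall_infinite_inter_Ioi hJ hx
    obtain ⟨s, hs, hsep⟩ := ih (J.erase j) (Finset.erase_ssubset hj) (fun i => x i ∩ Set.Ioi b)
      fun i hi => hinf i (Finset.mem_of_mem_erase hi)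
    obtain ⟨t, ht⟩ : ∃ t : Set.powersetCard I 2, (t : Finset I) = {a, b} :=
      ⟨⟨{a, b}, Finset.card_pair hab.ne⟩, rfl⟩
    have hlt : ∀ i ∈ J, i ≠ j → BlockLT t (s i) := by
      intro i hi hij c hc d hd
      have hd' := (hs i (Finset.mem_erase.2 ⟨hij, hi⟩) hd).2
      rw [← Set.powersetCard.mem_coe_iff, ht, Finset.mem_insert, Finset.mem_singleton] at hc
      rcases hc with rfl | rfl
      exacts [hab.trans hd', hd']
    refine ⟨Function.update s j t, fun i hi => ?_, fun i hi k hk hik => ?_⟩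
    · by_cases hij : i = j
      · subst hij
        rw [Function.update_self, ht]
        intro c hc
        rcases (by simpa using hc : c = a ∨ c = b) with rfl | rfl <;> assumption
      · rw [Function.update_of_ne hij]
        exact (hs i (Finset.mem_erase.2 ⟨hij, hi⟩)).trans Set.inter_subset_left
    · by_cases hij : i = j
      · subst hij
        rw [Function.update_self, Function.update_of_ne hik.symm]
        exact Or.inl (hlt k hk hik.symm)
      · by_cases hkj : k = j
        · subst hkj
          rw [Function.update_self, Function.update_of_ne hij]
          exact Or.inr (hlt i hi hij)
        · simp only [Function.update_of_ne hij, Function.update_of_ne hkj]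
          exact hsep (by simpa [hij] using hi) (by simpa [hkj] using hk) hik

end BlockSequences

/-! ### The colouring and its homogeneous sets. -/

section Coloring

variable {I : Type u} [LinearOrder I]

open Classical in
/-- The number of members of `S` that lie below `t`. -/
noncomputable def blockRank (S : Finset (Set.powersetCard I 2)) (t : Set.powersetCard I 2) : ℕ :=
  (S.filter fun u => BlockLT u t).card

section Blocks

variable {ι : Type*} {x : ι → Set I}

/-- If the two sets interleave, pairs catching both order violations cannot be comparable as blocks.
-/
theorem forall_lt_or_forall_lt (hx : ∀ i, (x i).Infinite)
    (hdisj : Pairwise fun i j => Disjoint (x i) (x j))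
    (hsep : ∀ s : ι → Set.powersetCard I 2, (∀ i, ((s i : Finset I) : Set I) ⊆ x i) →
      IsBlockFamily (Set.range s)) {i j : ι} (hij : i ≠ j) :
    (∀ a ∈ x i, ∀ b ∈ x j, a < b) ∨ (∀ b ∈ x j, ∀ a ∈ x i, b < a) := by
  classical
  by_contra! hcon
  obtain ⟨⟨a, ha, b, hb, hba⟩, b', hb', a', ha', hab⟩ := hcon
  choose r hr using fun i => (hx i).exists_powersetCard_subset
  obtain ⟨s, hs, has, has'⟩ := (hx i).exists_pair_subset ha ha'
  obtain ⟨t, ht, hbt, hbt'⟩ := (hx j).exists_pair_subset hb hb'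
  have hne : s ≠ t := by
    rintro rfl
    exact Set.disjoint_left.1 (hdisj hij) ha (ht has)
  have hfam := hsep (Function.update (Function.update r i s) j t) fun k => by
    by_cases hkj : k = j
    · subst hkj; simpa using ht
    · rw [Function.update_of_ne hkj]
      by_cases hki : k = i
      · subst hki; simpa using hs
      · rw [Function.update_of_ne hki]; exact hr k
  rcases hfam ⟨i, by simp [Function.update_of_ne hij]⟩ ⟨j, by simp⟩ hne with h | h
  · exact (h a has b hbt).not_ge hba
  · exact (h b' hbt' a' has').not_ge hab

variable [Fintype ι] {s : ι → Set.powersetCard I 2}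

-- The rank depends on the index only, not on the selection, so a recorded witness means the same
-- for every selection.
open Classical in
theorem blockRank_apply
    (hblock : ∀ i j, i ≠ j → (∀ a ∈ x i, ∀ b ∈ x j, a < b) ∨ (∀ b ∈ x j, ∀ a ∈ x i, b < a))
    (hdisj : Pairwise fun i j => Disjoint (x i) (x j))
    (hs : ∀ i, ((s i : Finset I) : Set I) ⊆ x i) {S : Finset (Set.powersetCard I 2)}
    (hS : (S : Set (Set.powersetCard I 2)) = Set.range s) (i : ι) :
    blockRank S (s i) = (Finset.univ.filter fun j => ∀ a ∈ x j, ∀ b ∈ x i, a < b).card := by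
  have hinj := injective_of_forall_subset hdisj hs
  have hS' : S = Finset.univ.map ⟨s, hinj⟩ := by
    apply Finset.coe_injective
    simp [hS]
  rw [blockRank, hS', Finset.filter_map, Finset.card_map]
  congr 1
  ext j
  simp only [Finset.mem_filter, Finset.mem_univ, true_and, Function.comp, Function.Embedding.coeFn_mk]
  refine ⟨fun h => ?_, fun h a ha b hb => h a (hs j ha) b (hs i hb)⟩
  obtain ⟨a, ha⟩ := Set.powersetCard.exists_mem (s j)
  obtain ⟨b, hb⟩ := Set.powersetCard.exists_mem (s i)
  rcases eq_or_ne j i with rfl | hji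
  · exact absurd (h a ha a ha) (lt_irrefl a)
  · exact (hblock j i hji).resolve_right fun h' =>
      (h a ha b hb).not_gt (h' b (hs i hb) a (hs j ha))

open Classical in
theorem injective_card_filter_forall_lt (hx : ∀ i, (x i).Infinite)
    (hblock : ∀ i j, i ≠ j → (∀ a ∈ x i, ∀ b ∈ x j, a < b) ∨ (∀ b ∈ x j, ∀ a ∈ x i, b < a)) :
    Function.Injective fun i =>
      (Finset.univ.filter fun j => ∀ a ∈ x j, ∀ b ∈ x i, a < b).card := by
  have key : ∀ i j, (∀ a ∈ x i, ∀ b ∈ x j, a < b) →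
      (Finset.univ.filter fun k => ∀ a ∈ x k, ∀ b ∈ x i, a < b).card <
        (Finset.univ.filter fun k => ∀ a ∈ x k, ∀ b ∈ x j, a < b).card := by
    intro i j hij
    obtain ⟨c, hc⟩ := (hx i).nonempty
    refine Finset.card_lt_card (Finset.ssubset_iff.2 ⟨i, ?_, ?_⟩)
    · simp only [Finset.mem_filter, Finset.mem_univ, true_and]
      exact fun h => lt_irrefl c (h c hc c hc)
    · intro k hk
      rcases Finset.mem_insert.1 hk with rfl | hk
      · simpa using hij
      · simp only [Finset.mem_filter, Finset.mem_univ, true_and] at hk ⊢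
        exact fun a ha b hb => (hk a ha c hc).trans (hij c hc b hb)
  intro i j hij
  by_contra hne
  rcases hblock i j hne with h | h
  exacts [(key i j h).ne hij, (key j i h).ne' hij]

end Blocks

variable {E : Type u} [NormedAddCommGroup E] [NormedSpace ℝ E]

open Classical in
/-- The pair `w` of integer coefficients and a set of ranks witnesses, with gap `1`, that the vectors
`z t` for `t ∈ S` are not `1`-unconditional. -/
def ViolatesUnconditionality (z : Set.powersetCard I 2 → E) (S : Finset (Set.powersetCard I 2))
    (w : (ℕ →₀ ℤ) × Finset ℕ) : Prop :=
  ‖∑ t ∈ S, (w.1 (blockRank S t) : ℝ) • z t‖ + 1 <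
    ‖∑ t ∈ S with blockRank S t ∈ w.2, (w.1 (blockRank S t) : ℝ) • z t‖

open Classical in
/-- The coloring of finite families of pairs that records whether the family is a block family and,
if so, a witness for the failure of `1`-unconditionality of the associated vectors. -/
noncomputable def unconditionalityColor (z : Set.powersetCard I 2 → E)
    (S : Finset (Set.powersetCard I 2)) : Option (Option ((ℕ →₀ ℤ) × Finset ℕ)) :=
  if IsBlockFamily (S : Set (Set.powersetCard I 2)) then
    some (if h : ∃ w, ViolatesUnconditionality z S w then some h.choose else none)
  else none

variable {ι : Type*} [Fintype ι] {x : ι → Set I} {e : I → E} {z : Set.powersetCard I 2 → E}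

theorem exists_norm_sum_le_add_one (hx : ∀ i, (x i).Infinite) (he : ∀ a, ‖e a‖ ≤ 1)
    (hz : ∀ t : Set.powersetCard I 2, ∃ a b, (t : Finset I) = {a, b} ∧ z t = e a - e b)
    (β : ι → ℝ) (F : Finset ι) :
    ∃ s : ι → Set.powersetCard I 2, (∀ i, ((s i : Finset I) : Set I) ⊆ x i) ∧
      ‖∑ i ∈ F, β i • z (s i)‖ ≤ ‖∑ i, β i • z (s i)‖ + 1 := by
  classical
  choose r hr using fun i => (hx i).exists_powersetCard_subset
  obtain ⟨f, hf, hfr⟩ := exists_dual_vector'' ℝ (∑ i ∈ F, β i • z (r i))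
  rw [RCLike.ofReal_real_eq_id, id] at hfr
  set B := ∑ i, |β i|
  have hB : 0 ≤ B := Finset.sum_nonneg fun i _ => abs_nonneg _
  have hsmall : ∀ i, ∃ t : Set.powersetCard I 2, ((t : Finset I) : Set I) ⊆ x i ∧
      |f (z t)| ≤ (B + 1)⁻¹ := by
    intro i
    obtain ⟨a, ha, b, hb, hab, h⟩ :=
      -- With this bound the terms outside `F` contribute at most `B / (B + 1)`, hence at most 1, to
      -- `f`; adding 1 to `B` covers `B = 0`.
      (hx i).exists_ne_abs_apply_sub_lt he f (show 0 < (B + 1)⁻¹ by positivity)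
    refine ⟨⟨{a, b}, Finset.card_pair hab⟩, ?_, ?_⟩
    · intro c hc
      rcases (by simpa using hc : c = a ∨ c = b) with rfl | rfl <;> assumption
    · obtain ⟨a', b', ht, hzt⟩ := hz ⟨{a, b}, Finset.card_pair hab⟩
      change ({a, b} : Finset I) = {a', b'} at ht
      have hab' : a' = a ∧ b' = b ∨ a' = b ∧ b' = a := by
        have h1 : a ∈ ({a', b'} : Finset I) := ht ▸ by simp
        have h2 : b ∈ ({a', b'} : Finset I) := ht ▸ by simp
        simp only [Finset.mem_insert, Finset.mem_singleton] at h1 h2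
        grind
      rw [hzt]
      rcases hab' with ⟨rfl, rfl⟩ | ⟨rfl, rfl⟩
      · exact h.le
      · rw [← neg_sub, map_neg, abs_neg]
        exact h.le
  choose q hq hqf using hsmall
  refine ⟨fun i => if i ∈ F then r i else q i, fun i => ?_, ?_⟩
  · dsimp only
    split_ifs
    exacts [hr i, hq i]
  have hF : ∑ i ∈ F, β i • z (if i ∈ F then r i else q i) = ∑ i ∈ F, β i • z (r i) :=
    Finset.sum_congr rfl fun i hi => by rw [if_pos hi]
  have hFc : ∑ i ∈ Fᶜ, β i • z (if i ∈ F then r i else q i) = ∑ i ∈ Fᶜ, β i • z (q i) :=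
    Finset.sum_congr rfl fun i hi => by rw [if_neg (Finset.mem_compl.1 hi)]
  rw [← Finset.sum_add_sum_compl F, hF, hFc, ← hfr]
  have hle : f (∑ i ∈ F, β i • z (r i) + ∑ i ∈ Fᶜ, β i • z (q i)) ≤
      ‖∑ i ∈ F, β i • z (r i) + ∑ i ∈ Fᶜ, β i • z (q i)‖ :=
    (le_abs_self _).trans ((f.le_opNorm _).trans (mul_le_of_le_one_left (norm_nonneg _) hf))
  have htail : |f (∑ i ∈ Fᶜ, β i • z (q i))| ≤ 1 := by
    rw [map_sum]
    calc _ ≤ ∑ i ∈ Fᶜ, |f (β i • z (q i))| := Finset.abs_sum_le_sum_abs _ _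
      _ ≤ ∑ i ∈ Fᶜ, |β i| * (B + 1)⁻¹ := Finset.sum_le_sum fun i _ => by
        rw [map_smul, smul_eq_mul, abs_mul]
        exact mul_le_mul_of_nonneg_left (hqf i) (abs_nonneg _)
      _ ≤ ∑ i, |β i| * (B + 1)⁻¹ := Finset.sum_le_univ_sum_of_nonneg fun i => by positivity
      _ ≤ 1 := by
        rw [← Finset.sum_mul, ← div_eq_mul_inv, div_le_one (by positivity)]
        linarith
  rw [map_add] at hle
  linarith [neg_le_of_abs_le htail]

theorem norm_sum_le_of_unconditionalityColor_eq [WellFoundedLT I] [Nonempty (Set.powersetCard I 2)]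
    (hx : ∀ i, (x i).Infinite) (hdisj : Pairwise fun i j => Disjoint (x i) (x j))
    (he : ∀ a, ‖e a‖ ≤ 1)
    (hz : ∀ t : Set.powersetCard I 2, ∃ a b, (t : Finset I) = {a, b} ∧ z t = e a - e b)
    {k : Option (Option ((ℕ →₀ ℤ) × Finset ℕ))}
    (hk : ∀ s : ι → Set.powersetCard I 2, (∀ i, ((s i : Finset I) : Set I) ⊆ x i) →
      ∀ S : Finset (Set.powersetCard I 2), (S : Set (Set.powersetCard I 2)) = Set.range s →
        unconditionalityColor z S = k)
    {s : ι → Set.powersetCard I 2} (hs : ∀ i, ((s i : Finset I) : Set I) ⊆ x i) (F : Finset ι)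
    (a : ι → ℝ) : ‖∑ i ∈ F, a i • z (s i)‖ ≤ ‖∑ i, a i • z (s i)‖ := by
  classical
  have himage : ∀ s : ι → Set.powersetCard I 2,
      ((Finset.univ.image s : Finset _) : Set (Set.powersetCard I 2)) = Set.range s := by simp
  have hk0 : k ≠ none := by
    obtain ⟨s, hs, hsep⟩ := exists_pairwise_blockLT Finset.univ x fun i _ => hx i
    rw [← hk s (fun i => hs i (Finset.mem_univ i)) _ (himage s), unconditionalityColor, if_pos]
    · simp
    · rw [himage]
      rintro _ ⟨i, rfl⟩ _ ⟨j, rfl⟩ hij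
      exact hsep (by simp) (by simp) fun h => hij (h ▸ rfl)
  have hsep : ∀ s : ι → Set.powersetCard I 2, (∀ i, ((s i : Finset I) : Set I) ⊆ x i) →
      IsBlockFamily (Set.range s) := by
    intro s hs
    by_contra hcon
    refine hk0 ?_
    rw [← hk s hs _ (himage s), unconditionalityColor, if_neg]
    rwa [himage]
  have hblock := fun i j (hij : i ≠ j) => forall_lt_or_forall_lt hx hdisj hsep hij
  set ρ : ι → ℕ := fun i => (Finset.univ.filter fun j => ∀ a ∈ x j, ∀ b ∈ x i, a < b).card
  have hρ : Function.Injective ρ := injective_card_filter_forall_lt hx hblock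
  have hrank : ∀ s : ι → Set.powersetCard I 2, (∀ i, ((s i : Finset I) : Set I) ⊆ x i) →
      ∀ i, blockRank (Finset.univ.image s) (s i) = ρ i := fun s hs i =>
    blockRank_apply hblock hdisj hs (himage s) i
  have hviol : ∀ s : ι → Set.powersetCard I 2, (∀ i, ((s i : Finset I) : Set I) ⊆ x i) → ∀ w,
      ViolatesUnconditionality z (Finset.univ.image s) w ↔
        ‖∑ i, (w.1 (ρ i) : ℝ) • z (s i)‖ + 1 <
          ‖∑ i with ρ i ∈ w.2, (w.1 (ρ i) : ℝ) • z (s i)‖ := by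
    intro s hs w
    have hinj := injective_of_forall_subset hdisj hs
    rw [ViolatesUnconditionality, Finset.sum_filter, Finset.sum_filter,
      Finset.sum_image fun i _ j _ h => hinj h, Finset.sum_image fun i _ j _ h => hinj h]
    simp only [hrank s hs]
  have hnone : k = some none := by
    rcases hk' : k with _ | _ | w
    · exact absurd hk' hk0
    · rfl
    obtain ⟨s, hs, hle⟩ := exists_norm_sum_le_add_one hx he hz (fun i => (w.1 (ρ i) : ℝ))
      (Finset.univ.filter fun i => ρ i ∈ w.2)
    have hcol := hk s hs _ (himage s)
    rw [hk', unconditionalityColor, if_pos (by rw [himage]; exact hsep s hs)] at hcol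
    split_ifs at hcol with h
    · have hw := h.choose_spec
      rw [Option.some_inj.1 (Option.some_inj.1 hcol), hviol s hs] at hw
      exact absurd hw hle.not_gt
    · simp at hcol
  have hgood : ∀ w, ¬ ViolatesUnconditionality z (Finset.univ.image s) w := by
    have hcol := hk s hs _ (himage s)
    rw [hnone, unconditionalityColor, if_pos (by rw [himage]; exact hsep s hs)] at hcol
    split_ifs at hcol with h
    · simp at hcol
    · exact not_exists.1 h
  refine norm_sum_le_of_forall_int (fun i => z (s i)) F (fun b => ?_) a
  -- Coefficients and index set are transported to ranks along the injection `ρ`.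
  have h := hgood (Finsupp.embDomain ⟨ρ, hρ⟩ (Finsupp.equivFunOnFinite.symm b), F.image ρ)
  rw [hviol s hs, not_lt] at h
  have hemb : ∀ i, Finsupp.embDomain ⟨ρ, hρ⟩ (Finsupp.equivFunOnFinite.symm b) (ρ i) = b i :=
    fun i => Finsupp.embDomain_apply_self ⟨ρ, hρ⟩ _ i
  have hFil : (Finset.univ.filter fun i => ρ i ∈ F.image ρ) = F := by
    ext i
    simp [hρ.eq_iff]
  simpa only [hemb, hFil] using h

end Coloring

/-! ### Assembling the sequence. -/

theorem Cardinal.exists_injective_norm_le_one {E : Type u} [NormedAddCommGroup E] [NormedSpace ℝ E]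
    {κ : Cardinal.{u}} (hκ : densityCharacter E = κ) :
    ∃ e : κ.out → E, Function.Injective e ∧ ∀ a, ‖e a‖ ≤ 1 := by
  have h : Cardinal.mk κ.out ≤ Cardinal.mk E := by
    rw [Cardinal.mk_out, ← hκ, ← Cardinal.mk_univ]
    exact csInf_le' ⟨Set.univ, dense_univ, rfl⟩
  obtain ⟨g⟩ := h
  refine ⟨fun a => Homeomorph.unitBall (g a), fun a b hab => ?_, fun a => ?_⟩
  · exact g.injective (Homeomorph.unitBall.injective (Subtype.ext hab))
  · exact (mem_ball_zero_iff.1 (Homeomorph.unitBall (g a)).2).le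

theorem PolarizedPartition.hasUnconditionalBasicSequence {κ : Cardinal.{u}}
    (hκ : PolarizedPartition 2 κ) {E : Type u} [NormedAddCommGroup E] [NormedSpace ℝ E]
    (hE : densityCharacter E = κ) : HasUnconditionalBasicSequence E 1 := by
  classical
  obtain ⟨e, hinj, he⟩ := Cardinal.exists_injective_norm_le_one hE
  let _ : LinearOrder κ.out := IsWellOrder.linearOrder WellOrderingRel
  have : WellFoundedLT κ.out := ⟨WellOrderingRel.isWellOrder.wf⟩
  have hpair : ∀ t : Set.powersetCard κ.out 2, ∃ a b, a ≠ b ∧ (t : Finset κ.out) = {a, b} :=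
    fun t => Finset.card_eq_two.1 (Set.powersetCard.card_eq t)
  choose p q hpq ht using hpair
  set z : Set.powersetCard κ.out 2 → E := fun t => e (p t) - e (q t) with hzdef
  have hz : ∀ t : Set.powersetCard κ.out 2,
      ∃ a b, (t : Finset κ.out) = {a, b} ∧ z t = e a - e b := fun t => ⟨p t, q t, ht t, rfl⟩
  -- Finitely supported integer data is countable, so the colours can be coded by naturals.
  obtain ⟨g, hg⟩ := exists_injective_nat (Option (Option ((ℕ →₀ ℤ) × Finset ℕ)))
  obtain ⟨x, hx, hdisj, hhom⟩ := hκ fun S => g (unconditionalityColor z S)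
  choose s hs using fun n => (hx n).exists_powersetCard_subset
  have : Nonempty (Set.powersetCard κ.out 2) := ⟨s 0⟩
  have hunc : IsUnconditionalWith 1 fun n => z (s n) := by
    intro F G _ _ hFG a
    obtain ⟨m, hm⟩ : ∃ m, ∀ n ∈ G, n < m + 1 := by
      obtain ⟨m, hm⟩ := G.exists_nat_subset_range
      exact ⟨m, fun n hn => (Finset.mem_range.1 (hm hn)).trans m.lt_succ_self⟩
    obtain ⟨k, hk⟩ := hhom m
    have hconst : ∀ r : Fin (m + 1) → Set.powersetCard κ.out 2,
        (∀ i, ((r i : Finset κ.out) : Set κ.out) ⊆ x i) →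
        ∀ S : Finset (Set.powersetCard κ.out 2), (S : Set (Set.powersetCard κ.out 2)) = Set.range r →
          unconditionalityColor z S =
            unconditionalityColor z (Finset.univ.image fun i : Fin (m + 1) => s i) := by
      intro r hr S hS
      have hS' : S = Finset.univ.image r := Finset.coe_injective (by simp [hS])
      apply hg
      rw [hS']
      convert (hk r hr).trans (hk (fun i => s i) fun i => hs i).symm
    -- Setting the coefficients to 0 off `G` turns the sum over all indices up to `m` into the sum
    -- over `G`.
    have hle := norm_sum_le_of_unconditionalityColor_eq (x := fun i : Fin (m + 1) => x i)
      (fun i => hx i) (fun i j hij => hdisj i j fun h => hij (Fin.ext h)) he hz hconst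
      (fun i => hs i) (Finset.univ.filter fun i : Fin (m + 1) => (i : ℕ) ∈ F)
      (fun i => if (i : ℕ) ∈ G then a i else 0)
    have hsum : ∀ H ⊆ G, ∑ n ∈ H, a n • z (s n) =
        ∑ i ∈ Finset.univ.filter fun i : Fin (m + 1) => (i : ℕ) ∈ H,
          (if (i : ℕ) ∈ G then a i else 0) • z (s i) := by
      intro H hH
      symm
      refine Finset.sum_bij (fun i _ => (i : ℕ)) (by simp) (fun i _ j _ h => Fin.ext h)
        (fun n hn => ⟨⟨n, hm n (hH hn)⟩, by simpa using hn, rfl⟩) fun i hi => ?_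
      rw [if_pos (hH (by simpa using hi))]
    have hG : ∑ i ∈ Finset.univ.filter fun i : Fin (m + 1) => (i : ℕ) ∈ G,
          (if (i : ℕ) ∈ G then a i else 0) • z (s i) =
        ∑ i : Fin (m + 1), (if (i : ℕ) ∈ G then a i else 0) • z (s i) :=
      Finset.sum_filter_of_ne fun i _ hi => by
        by_contra h
        simp [h] at hi
    rw [one_mul, hsum F hFG, hsum G subset_rfl, hG]
    exact hle
  refine ⟨_, hunc.isBasicSequence fun n => ?_, hunc⟩
  rw [hzdef, sub_ne_zero]
  exact fun h => hpq _ (hinj h)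

theorem mainTheorem2 (κ : Cardinal.{u}) (hκ : PolarizedPartition 2 κ) :
    (∀ (E : Type u) [NormedAddCommGroup E] [NormedSpace ℝ E] [CompleteSpace E],
      densityCharacter E = κ → ¬ ContainsEllOne E → HasUnconditionalBasicSequence E 1) ∧
    (∀ (E : Type u) [NormedAddCommGroup E] [NormedSpace ℝ E] [CompleteSpace E],
      densityCharacter E = κ → ∀ ε : ℝ, 0 < ε → HasUnconditionalBasicSequence E (1 + ε)) := by
  refine ⟨fun E _ _ _ hE _ => hκ.hasUnconditionalBasicSequence hE, fun E _ _ _ hE ε hε => ?_⟩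
  exact (hκ.hasUnconditionalBasicSequence hE).mono (by linarith)
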